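/- For a prime power $q$ and an integer $k\ge 0$ put $$Q_\infty(k)=\frac{1}{q^{k^2}}\,\frac{\prod_{i=k+1}^{\infty}(1-q^{-i})}{\prod_{i=1}^{k}(1-q^{-i})}.$$ There is an absolute constant $\alpha_0>0$ such that for every $0<\alpha\le\alpha_0$ there are positive constants $C',c$ and an implied constant, depending only on $\alpha$, for which the following holds. Let $q$ be any prime power, let $n\ge 0$, and let $F_1,\dots,F_n\subseteq\{1,\dots,n\}$ be sets such that $|F_i|<\alpha n$ for every $i$ and every index $j\in\{1,\dots,n\}$ is contained in at most $(1-12\alpha)n$ of the sets $F_i$. For every integer $r$ with $(1-\alpha)n\le r\le n$, let $N_{F_1,\dots,F_n}$ be the number of $n\times n$ matrices $M$ over $\mathbf F_q$ of rank $r$ such that, for every $i$, the entries of the $i$-th column of $M$ in the rows $j\in F_i$ are all zero. Then $$N_{F_1,\dots,F_n}=q^{\,n^2-\sum_{i}|F_i|}\Big(Q_\infty(n-r)+O\big((C'/q)^{cn}\big)\Big).$$ -/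

import Mathlib

/-- The factors `1 - 1/q^i`, `i > k`, of the infinite product below do form a convergent product,
so that the product in `corankLimit` is the genuine one. -/
theorem multipliable_corankFactor {q : ℕ} (hq : 2 ≤ q) (k : ℕ) :
    Multipliable fun i : ℕ => (1 - 1 / (q : ℝ) ^ (k + 1 + i)) := by
  have hq' : (1 : ℝ) < q := by exact_mod_cast hq
  have h0 : (0 : ℝ) < q := by linarith
  have hs : Summable fun i : ℕ => -(1 / (q : ℝ) ^ (k + 1 + i)) := by
    have h := (summable_geometric_of_lt_one (inv_nonneg.2 h0.le)
      (inv_lt_one_of_one_lt₀ hq')).mul_left (((q : ℝ)⁻¹) ^ (k + 1))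
    refine (h.congr fun i => ?_).neg
    rw [← pow_add, inv_pow, one_div]
  have := Real.multipliable_one_add_of_summable hs
  simpa [sub_eq_add_neg] using this

/-- The limiting corank law over a field with `q` elements:
`P(Q_∞ = k) = q^{-k²} ∏_{i ≥ k+1} (1 - q^{-i}) / ∏_{i=1}^{k} (1 - q^{-i})`. -/
noncomputable def corankLimit (q k : ℕ) : ℝ :=
  1 / (q : ℝ) ^ (k ^ 2) *
    ((∏' i : ℕ, (1 - 1 / (q : ℝ) ^ (k + 1 + i))) /
      ∏ i ∈ Finset.Icc 1 k, (1 - 1 / (q : ℝ) ^ i))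

/-- The condition on the index sets `S 1, …, S n ⊆ [n]` with parameter `α`: each of them has fewer
than `α n` elements, and each index lies in at most `(1 - 12 α) n` of them. -/
structure SparsePattern (α : ℝ) {n : ℕ} (S : Fin n → Finset (Fin n)) : Prop where
  card_lt : ∀ i : Fin n, ((S i).card : ℝ) < α * n
  mem_le : ∀ j : Fin n,
    ((Finset.univ.filter fun i : Fin n => j ∈ S i).card : ℝ) ≤ (1 - 12 * α) * n

/-- The number of `n × n` matrices of rank `r` over `K` such that, for every `i`, the entries of
the `i`-th column in the rows `j ∈ S i` vanish. -/
noncomputable def zeroPatternCount (K : Type*) [Field K] {n : ℕ}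
    (S : Fin n → Finset (Fin n)) (r : ℕ) : ℕ :=
  Nat.card {M : Matrix (Fin n) (Fin n) K // M.rank = r ∧ ∀ i, ∀ j ∈ S i, M j i = 0}

/-! Expose the first `m` columns, then the last `t`, with `t` about `2αn`. If the first `m` are
independent and their span `U` is transverse to every space `V₂ i` of admissible later columns, then
each later column is uniform modulo `U`, in a quotient of dimension `t`. The rank gained is
therefore that of a uniform `t × t` matrix; `natCard_finrank_sup_span` proves this exactly, one
vector at a time, and `abs_rankLaw_sub_corankLimit_le` compares that law with the limit.

The first `m` columns fail only rarely, by union bounds. A relation with given coefficients has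
probability at most `q^{-(n-g)}`, where `g` bounds all `|S i|`, against `q^m` choices of
coefficients (`natCard_not_linearIndependent_le`). If transversality to `V₂ i` fails, a nonzero
functional kills `V₂ i` and the first `m` columns (`natCard_not_sup_eq_top_le`). There are at most
`q^{|S i|}` such functionals. Where one has a nonzero coefficient `l`, necessarily `l ∈ S i`, and
since `l` lies in few of the sets, at least `2t` of the first column spaces escape its kernel, each
costing a factor `1/q`. -/

/-! ### The rank law of a uniform matrix and its limit -/

/-- The probability that a uniformly random `d × s` matrix over the field with `1 / x` elements has
rank `ρ`. -/
noncomputable def rankLaw (x : ℝ) (s d ρ : ℕ) : ℝ :=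
  x ^ ((d - ρ) * (s - ρ)) *
    ((∏ i ∈ Finset.range ρ, (1 - x ^ (d - i))) * (∏ i ∈ Finset.range ρ, (1 - x ^ (s - i))) /
      ∏ i ∈ Finset.range ρ, (1 - x ^ (i + 1)))

/-- The factor `i = d` is `1 - x ^ 0`. Hence `rankLaw` vanishes at impossible ranks despite
truncated subtraction. -/
theorem prod_one_sub_pow_sub_eq_zero (x : ℝ) {d ρ : ℕ} (h : d < ρ) :
    ∏ i ∈ Finset.range ρ, (1 - x ^ (d - i)) = 0 :=
  Finset.prod_eq_zero (Finset.mem_range.2 h) (by simp)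

theorem prod_one_sub_pow_succ_sub (x : ℝ) (d ρ : ℕ) :
    ∏ i ∈ Finset.range (ρ + 1), (1 - x ^ (d + 1 - i)) =
      (1 - x ^ (d + 1)) * ∏ i ∈ Finset.range ρ, (1 - x ^ (d - i)) := by
  rw [Finset.prod_range_succ', mul_comm]
  simp

theorem rankLaw_zero_right (x : ℝ) (s d : ℕ) : rankLaw x s d 0 = x ^ (d * s) := by
  simp [rankLaw]

theorem rankLaw_eq_zero_of_cols_lt (x : ℝ) {s d ρ : ℕ} (h : s < ρ) : rankLaw x s d ρ = 0 := by
  simp [rankLaw, prod_one_sub_pow_sub_eq_zero x h]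

theorem rankLaw_eq_zero_of_rows_lt (x : ℝ) {s d ρ : ℕ} (h : d < ρ) : rankLaw x s d ρ = 0 := by
  simp [rankLaw, prod_one_sub_pow_sub_eq_zero x h]

/-- Conditioning on the first vector: it falls in a subspace of codimension `d + 1` with probability
`x ^ (d + 1)`, and otherwise lowers the codimension by one. -/
theorem rankLaw_succ {x : ℝ} (h0 : 0 ≤ x) (h1 : x < 1) (s d ρ : ℕ) :
    rankLaw x (s + 1) (d + 1) (ρ + 1) =
      x ^ (d + 1) * rankLaw x s (d + 1) (ρ + 1) + (1 - x ^ (d + 1)) * rankLaw x s d ρ := by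
  rcases lt_or_ge d ρ with hd | hd
  · rw [rankLaw_eq_zero_of_rows_lt x hd, rankLaw_eq_zero_of_rows_lt x (Nat.succ_lt_succ hd),
      rankLaw_eq_zero_of_rows_lt x (Nat.succ_lt_succ hd)]
    simp
  have hD : ∀ k, ∏ i ∈ Finset.range k, (1 - x ^ (i + 1)) ≠ 0 := fun k =>
    Finset.prod_ne_zero_iff.2 fun i _ => (sub_pos.2 (pow_lt_one₀ h0 h1 (by simp))).ne'
  have hD' : 1 - x ^ (ρ + 1) ≠ 0 := (sub_pos.2 (pow_lt_one₀ h0 h1 (by simp))).ne'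
  have hρ := hD ρ
  obtain ⟨v, rfl⟩ := Nat.exists_eq_add_of_le hd
  rcases lt_trichotomy s ρ with hs | rfl | hs
  · rw [rankLaw_eq_zero_of_cols_lt x hs, rankLaw_eq_zero_of_cols_lt x (Nat.succ_lt_succ hs),
      rankLaw_eq_zero_of_cols_lt x (hs.trans (Nat.lt_succ_self _))]
    simp
  · rw [rankLaw_eq_zero_of_cols_lt x (Nat.lt_succ_self _)]
    simp only [rankLaw, prod_one_sub_pow_succ_sub]
    rw [Finset.prod_range_succ (fun i => 1 - x ^ (i + 1))]
    simp only [Nat.sub_self, mul_zero, pow_zero]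
    field_simp
    ring
  · obtain ⟨u, rfl⟩ := Nat.exists_eq_add_of_le (Nat.succ_le_of_lt hs)
    simp only [rankLaw, prod_one_sub_pow_succ_sub]
    rw [Finset.prod_range_succ (fun i => 1 - x ^ (i + 1)),
      Finset.prod_range_succ (fun i => 1 - x ^ (ρ.succ + u - i))]
    have e1 : ρ + v + 1 - (ρ + 1) = v := by omega
    have e2 : ρ.succ + u + 1 - (ρ + 1) = u + 1 := by omega
    have e3 : ρ.succ + u - (ρ + 1) = u := by omega
    have e4 : ρ + v - ρ = v := by omega
    have e5 : ρ.succ + u - ρ = u + 1 := by omega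
    simp only [e1, e2, e3, e4, e5]
    generalize ∏ i ∈ Finset.range ρ, (1 - x ^ (i + 1)) = D at hρ ⊢
    generalize ∏ i ∈ Finset.range ρ, (1 - x ^ (ρ + v - i)) = P
    generalize ∏ i ∈ Finset.range ρ, (1 - x ^ (ρ.succ + u - i)) = Q
    field_simp
    simp only [Nat.succ_eq_add_one]
    ring

/-- The term `2 * x ^ (a + 1 + N)` makes the induction close: for `x ≤ 1 / 2` its decrease at each
step pays for the new factor. -/
theorem prod_one_sub_pow_mem_Icc {x : ℝ} (h0 : 0 ≤ x) (h1 : x ≤ 1 / 2) (a N : ℕ) :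
    ∏ i ∈ Finset.range N, (1 - x ^ (a + 1 + i)) ∈
      Set.Icc (1 - 2 * x ^ (a + 1) + 2 * x ^ (a + 1 + N)) 1 := by
  have hf : ∀ i, x ^ i ≤ 1 := fun i => pow_le_one₀ h0 (by linarith)
  constructor
  · induction N with
    | zero => simp
    | succ N ih =>
      rw [Finset.prod_range_succ]
      have hp : ∏ i ∈ Finset.range N, (1 - x ^ (a + 1 + i)) ≤ 1 :=
        Finset.prod_le_one (fun i _ => by linarith [hf (a + 1 + i)])
          (fun i _ => by linarith [pow_nonneg h0 (a + 1 + i)])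
      have hx := pow_nonneg h0 (a + 1 + N)
      rw [← add_assoc, pow_succ x (a + 1 + N)]
      nlinarith [mul_le_mul_of_nonneg_right hp hx]
  · exact Finset.prod_le_one (fun i _ => by linarith [hf (a + 1 + i)])
      (fun i _ => by linarith [pow_nonneg h0 (a + 1 + i)])

theorem one_fourth_le_prod_one_sub_pow {x : ℝ} (h0 : 0 ≤ x) (h1 : x ≤ 1 / 2) (N : ℕ) :
    1 / 4 ≤ ∏ i ∈ Finset.range N, (1 - x ^ (i + 1)) := by
  cases N with
  | zero => norm_num
  | succ N =>
    -- The first factor is split off because at `x = 1 / 2` the general lower bound starting from it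
    -- tends to zero.
    rw [Finset.prod_range_succ']
    have h := (prod_one_sub_pow_mem_Icc h0 h1 1 N).1
    have e : ∀ i, 1 + 1 + i = i + 1 + 1 := fun i => by ring
    simp only [e] at h
    have hx := pow_nonneg h0 (N + 1 + 1)
    have : (1 / 2 : ℝ) ≤ ∏ i ∈ Finset.range N, (1 - x ^ (i + 1 + 1)) := by
      have : x ^ (1 + 1) ≤ (1 / 2) ^ (1 + 1) := pow_le_pow_left₀ h0 h1 _
      norm_num at this h
      linarith
    have hx' : (1 / 2 : ℝ) ≤ 1 - x ^ (0 + 1) := by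
      rw [zero_add, pow_one]
      linarith
    nlinarith

/-- Isolates the finite part of `corankLimit`, leaving one correction factor close to `1`. -/
theorem rankLaw_self {x : ℝ} (h0 : 0 ≤ x) (h1 : x < 1) (u k : ℕ) :
    rankLaw x (u + k) (u + k) u =
      x ^ (k ^ 2) * ((∏ i ∈ Finset.range u, (1 - x ^ (k + 1 + i))) *
        (∏ i ∈ Finset.range k, (1 - x ^ (u + 1 + i))) /
          ∏ i ∈ Finset.range k, (1 - x ^ (i + 1))) := by
  have hD : ∀ k, ∏ i ∈ Finset.range k, (1 - x ^ (i + 1)) ≠ 0 := fun k =>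
    Finset.prod_ne_zero_iff.2 fun i _ => (sub_pos.2 (pow_lt_one₀ h0 h1 (by simp))).ne'
  have hr : ∏ i ∈ Finset.range u, (1 - x ^ (u + k - i)) =
      ∏ i ∈ Finset.range u, (1 - x ^ (k + 1 + i)) := by
    rw [← Finset.prod_range_reflect]
    refine Finset.prod_congr rfl fun i hi => ?_
    have := Finset.mem_range.1 hi
    congr 2
    omega
  have h2 := Finset.prod_range_add (fun i => 1 - x ^ (i + 1)) u k
  have h3 := Finset.prod_range_add (fun i => 1 - x ^ (i + 1)) k u
  rw [add_comm k u, h2] at h3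
  have e : ∀ a i, a + i + 1 = a + 1 + i := fun a i => by ring
  simp only [e] at h3
  rw [rankLaw, hr]
  have e1 : u + k - u = k := by omega
  rw [e1, sq]
  congr 1
  rw [div_eq_div_iff (hD u) (hD k)]
  linear_combination -(∏ i ∈ Finset.range u, (1 - x ^ (k + 1 + i))) * h3

theorem abs_rankLaw_sub_corankLimit_le {q : ℕ} (hq : 2 ≤ q) (u k : ℕ) :
    |rankLaw (1 / q : ℝ) (u + k) (u + k) u - corankLimit q k| ≤ 8 * (1 / q : ℝ) ^ (u + k) := by
  have hq' : (2 : ℝ) ≤ q := by exact_mod_cast hq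
  have h0 : (0 : ℝ) ≤ 1 / q := by positivity
  have h1 : (1 / q : ℝ) ≤ 1 / 2 := one_div_le_one_div_of_le (by norm_num) hq'
  have hI : ∏ i ∈ Finset.Icc 1 k, (1 - 1 / (q : ℝ) ^ i) =
      ∏ i ∈ Finset.range k, (1 - (1 / q : ℝ) ^ (i + 1)) := by
    rw [← Finset.Ico_add_one_right_eq_Icc, Finset.prod_Ico_eq_prod_range]
    simp [add_comm]
  have hM := multipliable_corankFactor hq k
  have hM' := multipliable_corankFactor hq (k + u)
  have hT : ∏' i : ℕ, (1 - 1 / (q : ℝ) ^ (k + 1 + i)) =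
      (∏ i ∈ Finset.range u, (1 - (1 / q : ℝ) ^ (k + 1 + i))) *
        ∏' i : ℕ, (1 - 1 / (q : ℝ) ^ (k + u + 1 + i)) := by
    have e : ∀ i, k + 1 + (i + u) = k + u + 1 + i := fun i => by ring
    rw [← Multipliable.prod_mul_tprod_nat_mul' (k := u)
      (f := fun i : ℕ => (1 - 1 / (q : ℝ) ^ (k + 1 + i))) (by simpa only [e] using hM')]
    simp only [e, one_div_pow]
  have hTb : ∏' i : ℕ, (1 - 1 / (q : ℝ) ^ (k + u + 1 + i)) ∈
      Set.Icc (1 - 2 * (1 / q : ℝ) ^ (k + u + 1)) 1 := by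
    refine isClosed_Icc.mem_of_tendsto hM'.hasProd.tendsto_prod_nat (.of_forall fun N => ?_)
    have h := prod_one_sub_pow_mem_Icc h0 h1 (k + u) N
    simp only [one_div_pow] at h ⊢
    exact ⟨le_trans (by simp) h.1, h.2⟩
  rw [rankLaw_self h0 (by linarith), corankLimit, hI, hT]
  have hP := prod_one_sub_pow_mem_Icc h0 h1 k u
  have hP0 : 0 ≤ ∏ i ∈ Finset.range u, (1 - (1 / q : ℝ) ^ (k + 1 + i)) :=
    Finset.prod_nonneg fun i _ => sub_nonneg.2 (pow_le_one₀ h0 (by linarith))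
  have hR := prod_one_sub_pow_mem_Icc h0 h1 u k
  have hD := one_fourth_le_prod_one_sub_pow h0 h1 k
  set x : ℝ := 1 / q with hx
  set P := ∏ i ∈ Finset.range u, (1 - x ^ (k + 1 + i))
  set R := ∏ i ∈ Finset.range k, (1 - x ^ (u + 1 + i))
  set D := ∏ i ∈ Finset.range k, (1 - x ^ (i + 1))
  set T := ∏' i : ℕ, (1 - 1 / (q : ℝ) ^ (k + u + 1 + i))
  have hle : x ^ (k + u + 1) ≤ x ^ (u + 1) := pow_le_pow_of_le_one h0 (by linarith) (by omega)
  -- The correction factor `R` and the infinite tail `T` both lie just below `1`.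
  have hRT : |R - T| ≤ 2 * x ^ (u + 1) := by
    have := pow_nonneg h0 (u + 1 + k)
    rw [abs_le]
    constructor <;> linarith [hR.1, hR.2, hTb.1, hTb.2]
  have hPD : P / D ≤ 4 := by
    rw [div_le_iff₀ (by linarith)]
    linarith [hP.2]
  have hPD0 : 0 ≤ P / D := div_nonneg hP0 (by linarith)
  have hk0 : 0 ≤ x ^ (k ^ 2) := pow_nonneg h0 _
  have heq : x ^ (k ^ 2) * (P * R / D) - 1 / (q : ℝ) ^ (k ^ 2) * (P * T / D) =
      x ^ (k ^ 2) * ((P / D) * (R - T)) := by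
    rw [← one_div_pow]
    ring
  rw [heq, abs_mul, abs_mul, abs_of_nonneg hk0, abs_of_nonneg hPD0]
  calc x ^ (k ^ 2) * (P / D * |R - T|) ≤ x ^ (k ^ 2) * (4 * (2 * x ^ (u + 1))) := by gcongr
    _ = 8 * x ^ (k ^ 2 + u + 1) := by ring
    _ ≤ 8 * x ^ (u + k) := by
      have : u + k ≤ k ^ 2 + u + 1 := by nlinarith [sq_nonneg k, Nat.le_self_pow two_ne_zero k]
      have := pow_le_pow_of_le_one h0 (by linarith) this
      linarith

/-! ### Union bounds and fibrewise counting -/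

theorem natCard_subtype_exists_le {α β : Type*} [Finite α] [Fintype β] (p : β → α → Prop) :
    Nat.card {a // ∃ b, p b a} ≤ ∑ b, Nat.card {a // p b a} := by
  rw [← Nat.card_sigma]
  refine Nat.card_le_card_of_surjective
    (fun z : (b : β) × {a // p b a} => (⟨z.2.1, z.1, z.2.2⟩ : {a // ∃ b, p b a})) ?_
  rintro ⟨a, b, h⟩
  exact ⟨⟨b, a, h⟩, rfl⟩

theorem natCard_subtype_prod {α β : Type*} [Fintype α] [Finite β] (p : α × β → Prop) :
    Nat.card {z // p z} = ∑ a, Nat.card {b // p (a, b)} := by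
  rw [← Nat.card_sigma]
  exact Nat.card_congr (Equiv.subtypeProdEquivSigmaSubtype fun a b => p (a, b))

theorem natCard_subtype_cons {s : ℕ} {α : Fin (s + 1) → Type*} [Fintype (α 0)]
    [∀ i, Finite (α i)] (p : (∀ i, α i) → Prop) :
    Nat.card {x // p x} = ∑ a : α 0, Nat.card {x : ∀ i : Fin s, α i.succ // p (Fin.cons a x)} := by
  rw [← natCard_subtype_prod fun z : α 0 × ∀ i : Fin s, α i.succ => p (Fin.cons z.1 z.2)]
  exact Nat.card_congr ((Fin.consEquiv α).subtypeEquiv fun _ => Iff.rfl).symm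

/-! ### Random vectors from prescribed subspaces -/

section

variable {K W : Type*} [Field K] [AddCommGroup W] [Module K W]

theorem sup_span_range_cons {s : ℕ} {V : Fin (s + 1) → Submodule K W} (U : Submodule K W)
    (a : V 0) (x : ∀ i : Fin s, V i.succ) :
    U ⊔ Submodule.span K (Set.range fun i => ((Fin.cons a x : ∀ i, V i) i : W)) =
      (U ⊔ Submodule.span K {(a : W)}) ⊔ Submodule.span K (Set.range fun i => (x i : W)) := by
  have : (Set.range fun i => ((Fin.cons a x : ∀ i, V i) i : W)) =
      insert (a : W) (Set.range fun i => (x i : W)) := by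
    rw [← Fin.range_cons]
    congr 1
    funext i
    refine Fin.cases ?_ (fun j => ?_) i <;> simp
  rw [this, Submodule.span_insert, sup_assoc]

variable [Fintype K] [FiniteDimensional K W]

/-- A subspace `V` transverse to `U` meets `U` in a fraction `q ^ (-codim U)` of its elements. -/
theorem natCard_mem_of_sup_eq_top {U V : Submodule K W} (h : U ⊔ V = ⊤) {d : ℕ}
    (hd : Module.finrank K U + d = Module.finrank K W) :
    (Nat.card {x : V // (x : W) ∈ U} : ℝ) = (1 / Nat.card K : ℝ) ^ d * Nat.card V := by
  have : Finite W := Module.finite_of_finite K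
  have e : Nat.card {x : V // (x : W) ∈ U} = Nat.card (U ⊓ V : Submodule K W) :=
    Nat.card_congr
      { toFun := fun x => ⟨x.1.1, x.2, x.1.2⟩
        invFun := fun x => ⟨⟨x.1, x.2.2⟩, x.2.1⟩
        left_inv := fun _ => rfl
        right_inv := fun _ => rfl }
  have h1 := Submodule.finrank_sup_add_finrank_inf_eq U V
  rw [h, finrank_top] at h1
  have h2 : Module.finrank K V = d + Module.finrank K (U ⊓ V : Submodule K W) := by omega
  have hq : (Nat.card K : ℝ) ≠ 0 := by exact_mod_cast Nat.card_pos.ne'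
  rw [e, Module.natCard_eq_pow_finrank (K := K) (V := V), h2,
    Module.natCard_eq_pow_finrank (K := K)]
  push_cast
  rw [pow_add, one_div_pow]
  field_simp

/-- If every `V i` is transverse to `U`, then the dimension that a uniformly random element of
`∏ i, V i` adds to `U` is distributed like the rank of a uniformly random matrix. -/
theorem natCard_finrank_sup_span {s : ℕ} (V : Fin s → Submodule K W) (U : Submodule K W)
    (hV : ∀ i, U ⊔ V i = ⊤) {d : ℕ} (hd : Module.finrank K U + d = Module.finrank K W) (ρ : ℕ) :
    (Nat.card {x : ∀ i, V i // Module.finrank K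
      (U ⊔ Submodule.span K (Set.range fun i => (x i : W)) : Submodule K W) =
        Module.finrank K U + ρ} : ℝ) =
      (∏ i, (Nat.card (V i) : ℝ)) * rankLaw (1 / Nat.card K) s d ρ := by
  classical
  have : Finite W := Module.finite_of_finite K
  have : Fintype W := Fintype.ofFinite W
  have hq : (1 : ℝ) < Nat.card K := by exact_mod_cast Finite.one_lt_card
  induction s generalizing U d ρ with
  | zero =>
    have h : ∀ x : ∀ i, V i, Module.finrank K (U ⊔ Submodule.span K
        (Set.range fun i => (x i : W)) : Submodule K W) = Module.finrank K U := fun x => by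
      rw [Set.range_eq_empty, Submodule.span_empty, sup_bot_eq]
    simp only [h]
    cases ρ with
    | zero => simp [rankLaw_zero_right]
    | succ ρ => simp [rankLaw_eq_zero_of_cols_lt]
  | succ s ih =>
    rw [natCard_subtype_cons]
    push_cast
    have hcons : ∀ (a : V 0) (x : ∀ i : Fin s, V i.succ), Module.finrank K
        (U ⊔ Submodule.span K (Set.range fun i => ((Fin.cons a x : ∀ i, V i) i : W)) :
          Submodule K W) = Module.finrank K (U ⊔ Submodule.span K {(a : W)} ⊔
            Submodule.span K (Set.range fun i => (x i : W)) : Submodule K W) := fun a x => by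
      rw [sup_span_range_cons]
    simp only [hcons]
    have hV' : ∀ (a : V 0) (i : Fin s), U ⊔ Submodule.span K {(a : W)} ⊔ V i.succ = ⊤ :=
      fun a i => top_le_iff.1 ((hV i.succ).ge.trans (sup_le_sup_right le_sup_left _))
    have hin : ∀ a : V 0, (a : W) ∈ U → U ⊔ Submodule.span K {(a : W)} = U := fun a ha =>
      sup_eq_left.2 (by simpa [Submodule.span_le] using ha)
    have hout : ∀ a : V 0, (a : W) ∉ U →
        Module.finrank K (U ⊔ Submodule.span K {(a : W)} : Submodule K W) =
          Module.finrank K U + 1 := fun a ha => Submodule.finrank_sup_span_singleton ha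
    have hcard := natCard_mem_of_sup_eq_top (hV 0) hd
    rw [Nat.card_eq_fintype_card, Fintype.card_subtype] at hcard
    have hcompl := Finset.card_filter_add_card_filter_not (s := Finset.univ)
      (fun x : V 0 => (x : W) ∈ U)
    rw [Finset.card_univ, ← Nat.card_eq_fintype_card] at hcompl
    have hcompl' : (((Finset.univ.filter fun x : V 0 => (x : W) ∉ U).card : ℕ) : ℝ) =
        (1 - (1 / Nat.card K : ℝ) ^ d) * Nat.card (V 0) := by
      rw [← hcompl] at hcard ⊢
      push_cast at hcard ⊢
      linarith
    set c₁ := ∏ i : Fin s, (Nat.card (V i.succ) : ℝ) with hc₁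
    -- Here `c` is the conditional probability once the first vector lies outside `U`; the cases
    -- below differ only in its value.
    have key : ∀ c : ℝ, (∀ a : V 0, (a : W) ∉ U →
        (Nat.card {x : ∀ i : Fin s, V i.succ // Module.finrank K
          (U ⊔ Submodule.span K {(a : W)} ⊔ Submodule.span K (Set.range fun i => (x i : W)) :
            Submodule K W) = Module.finrank K U + ρ} : ℝ) = c₁ * c) →
        ∑ a : V 0, (Nat.card {x : ∀ i : Fin s, V i.succ // Module.finrank K
          (U ⊔ Submodule.span K {(a : W)} ⊔ Submodule.span K (Set.range fun i => (x i : W)) :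
            Submodule K W) = Module.finrank K U + ρ} : ℝ) =
          Nat.card (V 0) * c₁ * ((1 / Nat.card K : ℝ) ^ d * rankLaw (1 / Nat.card K) s d ρ +
            (1 - (1 / Nat.card K : ℝ) ^ d) * c) := by
      intro c hc
      rw [← Finset.sum_filter_add_sum_filter_not _ fun x : V 0 => (x : W) ∈ U,
        Finset.sum_congr rfl (g := fun _ => c₁ * rankLaw (1 / Nat.card K) s d ρ)
          (fun a ha => ?_),
        Finset.sum_congr (s₁ := Finset.univ.filter fun x : V 0 => (x : W) ∉ U) rfl
          (g := fun _ => c₁ * c) (fun a ha => hc a (Finset.mem_filter.1 ha).2),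
        Finset.sum_const, Finset.sum_const, nsmul_eq_mul, nsmul_eq_mul, hcard, hcompl']
      · ring
      · rw [hin a (Finset.mem_filter.1 ha).2]
        exact ih _ U (fun i => hV i.succ) hd ρ
    rw [Fin.prod_univ_succ, ← hc₁]
    cases ρ with
    | zero =>
      rw [key 0 fun a ha => ?_]
      · simp only [rankLaw_zero_right]
        ring
      · rw [mul_zero, Nat.cast_eq_zero, Nat.card_eq_zero]
        refine Or.inl ⟨fun x => ?_⟩
        have h1 := x.2
        have h2 := hout a ha
        have h3 := Submodule.finrank_mono (le_sup_left : U ⊔ Submodule.span K {(a : W)} ≤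
          U ⊔ Submodule.span K {(a : W)} ⊔ Submodule.span K (Set.range fun i => (x.1 i : W)))
        omega
    | succ ρ =>
      cases d with
      | zero =>
        rw [key 0 fun a ha => ?_]
        · simp [rankLaw_eq_zero_of_rows_lt]
        · have hU : U = ⊤ := Submodule.eq_top_of_finrank_eq hd
          exact absurd (hU ▸ Submodule.mem_top) ha
      | succ d =>
        rw [key (rankLaw (1 / Nat.card K) s d ρ) fun a ha => ?_]
        · rw [rankLaw_succ (by positivity) (by rw [div_lt_one (by linarith)]; exact hq)]
        · rw [← ih _ _ (hV' a) (by rw [hout a ha]; omega), hout a ha]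
          simp only [add_assoc, add_comm 1 ρ]

/-- The exact count with `U = ⊥` and every `V i = ⊤` exhibits `rankLaw` as a genuine probability. -/
theorem rankLaw_mem_Icc (K : Type*) [Field K] [Fintype K] (s d ρ : ℕ) :
    rankLaw (1 / Nat.card K) s d ρ ∈ Set.Icc 0 1 := by
  have h := natCard_finrank_sup_span (fun _ : Fin s => (⊤ : Submodule K (Fin d → K))) ⊥
    (fun _ => by simp) (d := d) (by simp) ρ
  have hle := Finite.card_subtype_le fun x : Fin s → (⊤ : Submodule K (Fin d → K)) =>
    Module.finrank K ((⊥ : Submodule K (Fin d → K)) ⊔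
      Submodule.span K (Set.range fun i => (x i : Fin d → K)) : Submodule K (Fin d → K)) =
        Module.finrank K (⊥ : Submodule K (Fin d → K)) + ρ
  rw [Nat.card_pi (β := fun _ : Fin s => (⊤ : Submodule K (Fin d → K))),
    ← Nat.cast_le (α := ℝ), h, Nat.cast_prod] at hle
  have hpos : 0 < ∏ _ : Fin s, (Nat.card (⊤ : Submodule K (Fin d → K)) : ℝ) :=
    Finset.prod_pos fun _ _ => by exact_mod_cast Nat.card_pos
  constructor
  · by_contra! hneg
    have h0 : (0 : ℝ) ≤ _ := h ▸ Nat.cast_nonneg _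
    exact absurd h0 (not_le.2 (mul_neg_of_pos_of_neg hpos hneg))
  · exact le_of_mul_le_mul_left (by simpa using hle) hpos

/-- Union bound over nonzero coefficient vectors: if `g k ≠ 0`, the relation determines the `k`-th
vector from the others. -/
theorem natCard_not_linearIndependent_le {m : ℕ} (V : Fin m → Submodule K W) {w : ℕ}
    (hw : ∀ i, w ≤ Module.finrank K (V i)) :
    Nat.card {a : ∀ i, V i // ¬ LinearIndependent K fun i => (a i : W)} * Nat.card K ^ w ≤
      Nat.card K ^ m * ∏ i, Nat.card (V i) := by
  classical
  have : Finite W := Module.finite_of_finite K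
  have hq : 0 < Nat.card K := Nat.card_pos
  have h1 : Nat.card {a : ∀ i, V i // ¬ LinearIndependent K fun i => (a i : W)} ≤
      ∑ g : {g : Fin m → K // g ≠ 0}, Nat.card {a : ∀ i, V i // ∑ i, g.1 i • (a i : W) = 0} := by
    refine le_trans (Nat.card_le_card_of_injective (Subtype.map id fun a ha => ?_)
      (Subtype.map_injective _ Function.injective_id))
      (natCard_subtype_exists_le fun (g : {g : Fin m → K // g ≠ 0}) (a : ∀ i, V i) =>
        ∑ i, g.1 i • (a i : W) = 0)
    obtain ⟨g, hg, i, hi⟩ := Fintype.not_linearIndependent_iff.1 ha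
    exact ⟨⟨g, fun h => hi (congrFun h i)⟩, hg⟩
  have h2 : ∀ g : {g : Fin m → K // g ≠ 0},
      Nat.card {a : ∀ i, V i // ∑ i, g.1 i • (a i : W) = 0} * Nat.card K ^ w ≤
        ∏ i, Nat.card (V i) := by
    rintro ⟨g, hg⟩
    obtain ⟨k, hk⟩ := Function.ne_iff.1 hg
    have h3 : Nat.card {a : ∀ i, V i // ∑ i, g i • (a i : W) = 0} ≤
        Nat.card (∀ i : {i // i ≠ k}, V i.1) := by
      refine Nat.card_le_card_of_injective (fun a i => a.1 i.1) fun a b hab => ?_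
      have hab' : ∀ i, i ≠ k → a.1 i = b.1 i := fun i hi => congrFun hab ⟨i, hi⟩
      have hs := a.2.trans b.2.symm
      rw [← Finset.add_sum_erase _ _ (Finset.mem_univ k),
        ← Finset.add_sum_erase _ _ (Finset.mem_univ k),
        Finset.sum_congr rfl fun i hi => by rw [hab' i (Finset.ne_of_mem_erase hi)]] at hs
      have hs' := smul_right_injective W hk (add_right_cancel hs)
      ext i : 2
      by_cases hi : i = k
      · subst hi
        exact Subtype.ext hs'
      · exact hab' i hi
    have h4 : ∏ i, Nat.card (V i) = Nat.card (V k) * Nat.card (∀ i : {i // i ≠ k}, V i.1) := by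
      rw [Nat.card_pi, Fintype.prod_eq_mul_prod_subtype_ne]
    rw [h4, mul_comm]
    refine Nat.mul_le_mul ?_ h3
    rw [Module.natCard_eq_pow_finrank (K := K) (V := V k)]
    exact Nat.pow_le_pow_right hq (hw k)
  calc _ ≤ (∑ g : {g : Fin m → K // g ≠ 0},
        Nat.card {a : ∀ i, V i // ∑ i, g.1 i • (a i : W) = 0}) * Nat.card K ^ w :=
        Nat.mul_le_mul_right _ h1
    _ ≤ ∑ g : {g : Fin m → K // g ≠ 0}, ∏ i, Nat.card (V i) := by
        rw [Finset.sum_mul]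
        exact Finset.sum_le_sum fun g _ => h2 g
    _ ≤ _ := by
        rw [Finset.sum_const, smul_eq_mul, Finset.card_univ, ← Nat.card_eq_fintype_card]
        refine Nat.mul_le_mul_right _ ((Finite.card_subtype_le _).trans ?_)
        simp

/-- Few tuples in `∏ j, V j` are annihilated by a functional that vanishes on few of the `V j`. -/
theorem natCard_forall_apply_eq_zero_le {m : ℕ} (V : Fin m → Submodule K W)
    (φ : Module.Dual K W) {w : ℕ} (hw : w ≤ Nat.card {j // ¬ V j ≤ LinearMap.ker φ}) :
    Nat.card {a : ∀ j, V j // ∀ j, φ (a j) = 0} * Nat.card K ^ w ≤ ∏ j, Nat.card (V j) := by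
  classical
  have : Finite W := Module.finite_of_finite K
  have hq : 0 < Nat.card K := Nat.card_pos
  have h1 : Nat.card {a : ∀ j, V j // ∀ j, φ (a j) = 0} =
      ∏ j, Nat.card {v : V j // φ v = 0} := by
    rw [← Nat.card_pi]
    exact Nat.card_congr (Equiv.subtypePiEquivPi (p := fun {j} (v : V j) => φ v = 0))
  have h2 : ∀ j, Nat.card {v : V j // φ v = 0} *
      (if V j ≤ LinearMap.ker φ then 1 else Nat.card K) ≤ Nat.card (V j) := by
    intro j
    split_ifs with h
    · rw [mul_one]
      exact Finite.card_subtype_le _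
    · obtain ⟨v, hv, hφ⟩ := SetLike.not_le_iff_exists.1 h
      rw [LinearMap.mem_ker] at hφ
      rw [← Nat.card_prod]
      -- Translating kernel elements by multiples of `v` embeds `q` disjoint copies of the kernel in
      -- `V j`.
      refine Nat.card_le_card_of_injective
        (fun z : {v : V j // φ v = 0} × K => (z.1.1 + z.2 • ⟨v, hv⟩ : V j)) ?_
      rintro ⟨⟨a, ha⟩, c⟩ ⟨⟨b, hb⟩, c'⟩ h
      have hc : c = c' := by
        have := congrArg (fun z : V j => φ z) h
        simpa [ha, hb, hφ] using this
      subst hc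
      simpa using h
  calc _ ≤ Nat.card {a : ∀ j, V j // ∀ j, φ (a j) = 0} *
        Nat.card K ^ Nat.card {j // ¬ V j ≤ LinearMap.ker φ} :=
        Nat.mul_le_mul_left _ (Nat.pow_le_pow_right hq hw)
    _ = ∏ j, (Nat.card {v : V j // φ v = 0} *
        (if ¬ V j ≤ LinearMap.ker φ then Nat.card K else 1)) := by
        rw [Finset.prod_mul_distrib, h1, ← Finset.prod_filter, Finset.prod_const,
          Nat.card_eq_fintype_card (α := {j // ¬ V j ≤ LinearMap.ker φ}), Fintype.card_subtype]
    _ ≤ _ := Finset.prod_le_prod' fun j _ => by simpa only [ite_not] using h2 j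

/-- A proper subspace lies in the kernel of a nonzero functional, and those killing `V'` belong to
its annihilator. -/
theorem natCard_not_sup_eq_top_le {m : ℕ} (V : Fin m → Submodule K W) (V' : Submodule K W)
    {w : ℕ} (hw : ∀ φ : Module.Dual K W, φ ≠ 0 → V' ≤ LinearMap.ker φ →
      w ≤ Nat.card {j // ¬ V j ≤ LinearMap.ker φ}) :
    Nat.card {a : ∀ j, V j // Submodule.span K (Set.range fun j => (a j : W)) ⊔ V' ≠ ⊤} *
        Nat.card K ^ (Module.finrank K V' + w) ≤
      Nat.card K ^ Module.finrank K W * ∏ j, Nat.card (V j) := by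
  classical
  have : Finite W := Module.finite_of_finite K
  have : Finite (Module.Dual K W) := Module.finite_of_finite K
  have : Fintype (Module.Dual K W) := Fintype.ofFinite _
  set D := {φ : Module.Dual K W // φ ≠ 0 ∧ V' ≤ LinearMap.ker φ}
  have h1 : Nat.card {a : ∀ j, V j //
      Submodule.span K (Set.range fun j => (a j : W)) ⊔ V' ≠ ⊤} ≤
      ∑ φ : D, Nat.card {a : ∀ j, V j // ∀ j, φ.1 (a j) = 0} := by
    refine le_trans (Nat.card_le_card_of_injective (Subtype.map id fun a ha => ?_)
      (Subtype.map_injective _ Function.injective_id))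
      (natCard_subtype_exists_le fun (φ : D) (a : ∀ j, V j) => ∀ j, φ.1 (a j) = 0)
    obtain ⟨φ, hφ, hle⟩ := Submodule.exists_le_ker_of_lt_top _ (lt_top_iff_ne_top.2 ha)
    refine ⟨⟨φ, hφ, le_sup_right.trans hle⟩, fun j => ?_⟩
    exact hle (le_sup_left (a := Submodule.span K (Set.range fun j => (a j : W)))
      (Submodule.subset_span ⟨j, rfl⟩))
  have h2 : Nat.card D * Nat.card K ^ Module.finrank K V' ≤ Nat.card K ^ Module.finrank K W := by
    have h3 : Nat.card D ≤ Nat.card V'.dualAnnihilator :=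
      Nat.card_le_card_of_injective
        (fun φ => ⟨φ.1, (Submodule.mem_dualAnnihilator _).2 fun v hv => φ.2.2 hv⟩)
        fun φ ψ h => Subtype.ext (Subtype.mk.inj h)
    rw [Module.natCard_eq_pow_finrank (K := K) (V := V'.dualAnnihilator)] at h3
    refine (Nat.mul_le_mul_right _ h3).trans ?_
    rw [← pow_add, add_comm, Subspace.finrank_add_finrank_dualAnnihilator_eq]
  calc _ ≤ (∑ φ : D, Nat.card {a : ∀ j, V j // ∀ j, φ.1 (a j) = 0}) *
        Nat.card K ^ (Module.finrank K V' + w) := Nat.mul_le_mul_right _ h1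
    _ = (∑ φ : D, Nat.card {a : ∀ j, V j // ∀ j, φ.1 (a j) = 0} * Nat.card K ^ w) *
        Nat.card K ^ Module.finrank K V' := by
        rw [← Finset.sum_mul]
        ring
    _ ≤ (∑ φ : D, ∏ j, Nat.card (V j)) * Nat.card K ^ Module.finrank K V' :=
        Nat.mul_le_mul_right _ (Finset.sum_le_sum fun φ _ =>
          natCard_forall_apply_eq_zero_le V φ.1 (hw φ.1 φ.2.1 φ.2.2))
    _ = (Nat.card D * Nat.card K ^ Module.finrank K V') * ∏ j, Nat.card (V j) := by
        rw [Finset.sum_const, smul_eq_mul, Finset.card_univ, ← Nat.card_eq_fintype_card]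
        ring
    _ ≤ _ := Nat.mul_le_mul_right _ h2

/-- If all but a proportion `β` of the tuples in `∏ i, V₁ i` are linearly independent with span
transverse to every `V₂ i`, then the rank of a random element of `∏ V₁ × ∏ V₂` follows `rankLaw`
up to `β`. -/
theorem abs_natCard_finrank_span_sub_le {m t : ℕ} (hW : Module.finrank K W = m + t)
    (V₁ : Fin m → Submodule K W) (V₂ : Fin t → Submodule K W) {β : ℝ}
    (hβ : (Nat.card {a : ∀ i, V₁ i // ¬ ((LinearIndependent K fun i => (a i : W)) ∧
      ∀ i, Submodule.span K (Set.range fun i => (a i : W)) ⊔ V₂ i = ⊤)} : ℝ) ≤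
        β * ∏ i, (Nat.card (V₁ i) : ℝ)) (ρ : ℕ) :
    |(Nat.card {z : (∀ i, V₁ i) × (∀ i, V₂ i) // Module.finrank K
        (Submodule.span K (Set.range fun i => (z.1 i : W)) ⊔
          Submodule.span K (Set.range fun i => (z.2 i : W)) : Submodule K W) = m + ρ} : ℝ) -
      ((∏ i, (Nat.card (V₁ i) : ℝ)) * ∏ i, (Nat.card (V₂ i) : ℝ)) *
        rankLaw (1 / Nat.card K) t t ρ| ≤
      β * ((∏ i, (Nat.card (V₁ i) : ℝ)) * ∏ i, (Nat.card (V₂ i) : ℝ)) := by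
  classical
  have : Finite W := Module.finite_of_finite K
  have : Fintype W := Fintype.ofFinite W
  set good : (∀ i, V₁ i) → Prop := fun a => (LinearIndependent K fun i => (a i : W)) ∧
      ∀ i, Submodule.span K (Set.range fun i => (a i : W)) ⊔ V₂ i = ⊤
  set f : (∀ i, V₁ i) → ℝ := fun a => Nat.card {b : ∀ i, V₂ i // Module.finrank K
        (Submodule.span K (Set.range fun i => (a i : W)) ⊔
          Submodule.span K (Set.range fun i => (b i : W)) : Submodule K W) = m + ρ}
  set c₂ := ∏ i, (Nat.card (V₂ i) : ℝ)
  set P := rankLaw (1 / Nat.card K) t t ρ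
  have hgood : ∀ a, good a → f a = c₂ * P := by
    intro a ha
    have hm := finrank_span_eq_card ha.1
    rw [Fintype.card_fin] at hm
    have := natCard_finrank_sup_span V₂ _ ha.2 (d := t) (by rw [hm, hW]) ρ
    rw [hm] at this
    exact this
  have hf : ∀ a, f a ∈ Set.Icc 0 c₂ := by
    refine fun a => ⟨Nat.cast_nonneg _, ?_⟩
    have := Finite.card_subtype_le fun b : ∀ i, V₂ i => Module.finrank K
        (Submodule.span K (Set.range fun i => (a i : W)) ⊔
          Submodule.span K (Set.range fun i => (b i : W)) : Submodule K W) = m + ρ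
    rw [Nat.card_pi (β := fun i => V₂ i)] at this
    rw [← Nat.cast_le (α := ℝ), Nat.cast_prod] at this
    exact this
  have hP : c₂ * P ∈ Set.Icc 0 c₂ := by
    have hP := rankLaw_mem_Icc K t t ρ
    have h0 : 0 ≤ c₂ := by positivity
    exact ⟨mul_nonneg h0 hP.1, mul_le_of_le_one_right h0 hP.2⟩
  have hbad : ∀ a, |f a - c₂ * P| ≤ if good a then 0 else c₂ := by
    intro a
    split_ifs with h
    · rw [hgood a h]
      simp
    · rw [abs_le]
      constructor <;> linarith [(hf a).1, (hf a).2, hP.1, hP.2]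
  have hsum : (Nat.card {z : (∀ i, V₁ i) × (∀ i, V₂ i) // Module.finrank K
        (Submodule.span K (Set.range fun i => (z.1 i : W)) ⊔
          Submodule.span K (Set.range fun i => (z.2 i : W)) : Submodule K W) = m + ρ} : ℝ) -
      ((∏ i, (Nat.card (V₁ i) : ℝ)) * c₂) * P = ∑ a, (f a - c₂ * P) := by
    rw [natCard_subtype_prod, Finset.sum_sub_distrib, Finset.sum_const, Finset.card_univ,
      ← Nat.card_eq_fintype_card, Nat.card_pi, nsmul_eq_mul]
    push_cast
    ring
  rw [hsum]
  calc _ ≤ ∑ a, if good a then 0 else c₂ :=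
        (Finset.abs_sum_le_sum_abs _ _).trans (Finset.sum_le_sum fun a _ => hbad a)
    _ = Nat.card {a // ¬ good a} * c₂ := by
        rw [Finset.sum_ite, Finset.sum_const_zero, zero_add, Finset.sum_const, nsmul_eq_mul,
          Nat.card_eq_fintype_card, Fintype.card_subtype]
    _ ≤ _ := by
        rw [← mul_assoc]
        exact mul_le_mul_of_nonneg_right hβ (by positivity)

end

/-! ### Coordinate subspaces and zero patterns -/

/-- The vectors whose coordinates in `s` vanish. -/
def vanishingOn (K : Type*) [Field K] {ι : Type*} (s : Finset ι) : Submodule K (ι → K) :=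
  ⨅ j ∈ (s : Set ι), LinearMap.ker (LinearMap.proj j : (ι → K) →ₗ[K] K)

theorem mem_vanishingOn {K : Type*} [Field K] {ι : Type*} {s : Finset ι} {v : ι → K} :
    v ∈ vanishingOn K s ↔ ∀ j ∈ s, v j = 0 := by
  simp [vanishingOn]

theorem finrank_vanishingOn (K : Type*) [Field K] {ι : Type*} [Fintype ι] [DecidableEq ι]
    (s : Finset ι) :
    Module.finrank K (vanishingOn K s) = Fintype.card ι - s.card := by
  have e := (LinearMap.iInfKerProjEquiv K (fun _ : ι => K) (I := ((sᶜ : Finset ι) : Set ι))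
    (J := (s : Set ι)) (by simpa using disjoint_compl_left) (by simp)).finrank_eq
  rw [vanishingOn, e]
  simp

/-- Take `l` with `φ` nonzero on the `l`-th basis vector, which lies in `vanishingOn K s` unless `l
∈ s`. One `l` serves every `s`. -/
theorem exists_mem_of_vanishingOn_le_ker {K : Type*} [Field K] {ι : Type*} [Finite ι]
    {φ : Module.Dual K (ι → K)} (hφ : φ ≠ 0) :
    ∃ l, ∀ s : Finset ι, vanishingOn K s ≤ LinearMap.ker φ → l ∈ s := by
  classical
  have : ∃ l, φ (Pi.single l 1) ≠ 0 := by
    by_contra! h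
    exact hφ (LinearMap.pi_ext' fun l => LinearMap.ext_ring (by simpa using h l))
  obtain ⟨l, hl⟩ := this
  refine ⟨l, fun s hs => ?_⟩
  by_contra hls
  refine hl (hs (mem_vanishingOn.2 fun j hj => ?_))
  exact Pi.single_eq_of_ne (by rintro rfl; exact hls hj) _

theorem rank_eq_finrank_span_sup {K : Type*} [Field K] {m t : ℕ} {ι : Type*}
    (M : Matrix ι (Fin (m + t)) K) :
    M.rank = Module.finrank K
      (Submodule.span K (Set.range fun i : Fin m => M.col (Fin.castAdd t i)) ⊔
        Submodule.span K (Set.range fun i : Fin t => M.col (Fin.natAdd m i)) :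
          Submodule K (ι → K)) := by
  have h : Set.range M.col = (Set.range fun i : Fin m => M.col (Fin.castAdd t i)) ∪
      Set.range fun i : Fin t => M.col (Fin.natAdd m i) := by
    ext v
    simp only [Set.mem_union, Set.mem_range]
    constructor
    · rintro ⟨i, rfl⟩
      exact Fin.addCases (fun i => Or.inl ⟨i, rfl⟩) (fun i => Or.inr ⟨i, rfl⟩) i
    · rintro (⟨i, rfl⟩ | ⟨i, rfl⟩)
      exacts [⟨_, rfl⟩, ⟨_, rfl⟩]
  rw [Matrix.rank_eq_finrank_span_cols, ← Submodule.span_union, h]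

theorem zeroPatternCount_eq (K : Type*) [Field K] [Fintype K] {m t : ℕ}
    (S : Fin (m + t) → Finset (Fin (m + t))) (r : ℕ) :
    zeroPatternCount K S r =
      Nat.card {z : (∀ i : Fin m, vanishingOn K (S (Fin.castAdd t i))) ×
          (∀ i : Fin t, vanishingOn K (S (Fin.natAdd m i))) // Module.finrank K
        (Submodule.span K (Set.range fun i => (z.1 i : Fin (m + t) → K)) ⊔
          Submodule.span K (Set.range fun i => (z.2 i : Fin (m + t) → K)) :
            Submodule K (Fin (m + t) → K)) = r} := by
  refine Nat.card_eq_of_bijective (fun M => ⟨(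
    fun i => ⟨M.1.col (Fin.castAdd t i), mem_vanishingOn.2 (M.2.2 _)⟩,
    fun i => ⟨M.1.col (Fin.natAdd m i), mem_vanishingOn.2 (M.2.2 _)⟩),
    (rank_eq_finrank_span_sup M.1).symm.trans M.2.1⟩) ⟨fun M N h => ?_, fun z => ?_⟩
  · obtain ⟨h1, h2⟩ := Prod.mk.inj (Subtype.mk.inj h)
    refine Subtype.ext (Matrix.ext_col fun i => ?_)
    refine Fin.addCases (fun i => ?_) (fun i => ?_) i
    · exact congrArg Subtype.val (congrFun h1 i)
    · exact congrArg Subtype.val (congrFun h2 i)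
  · obtain ⟨⟨a, b⟩, hz⟩ := z
    set M : Matrix (Fin (m + t)) (Fin (m + t)) K := Matrix.of fun j i =>
      Fin.addCases (motive := fun _ => K) (fun i => (a i : Fin (m + t) → K) j)
        (fun i => (b i : Fin (m + t) → K) j) i
    have ha : ∀ i, M.col (Fin.castAdd t i) = a i := fun i => by ext j; simp [M]
    have hb : ∀ i, M.col (Fin.natAdd m i) = b i := fun i => by ext j; simp [M]
    refine ⟨⟨M, ?_, fun i => ?_⟩, Subtype.ext (Prod.ext ?_ ?_)⟩
    · rw [rank_eq_finrank_span_sup]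
      rw [funext ha, funext hb]
      exact hz
    · refine Fin.addCases (fun i => ?_) (fun i => ?_) i
      · exact mem_vanishingOn.1 (ha i ▸ (a i).2 : M.col (Fin.castAdd t i) ∈ _)
      · exact mem_vanishingOn.1 (hb i ▸ (b i).2 : M.col (Fin.natAdd m i) ∈ _)
    · funext i
      exact Subtype.ext (ha i)
    · funext i
      exact Subtype.ext (hb i)

theorem prod_natCard_vanishingOn (K : Type*) [Field K] [Fintype K] {m t : ℕ}
    (S : Fin (m + t) → Finset (Fin (m + t))) :
    (∏ i, (Nat.card (vanishingOn K (S (Fin.castAdd t i))) : ℝ)) *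
        ∏ i, (Nat.card (vanishingOn K (S (Fin.natAdd m i))) : ℝ) =
      (Nat.card K : ℝ) ^ ((m + t) ^ 2 - ∑ i, (S i).card) := by
  rw [← Fin.prod_univ_add fun i => (Nat.card (vanishingOn K (S i)) : ℝ)]
  simp only [Module.natCard_eq_pow_finrank (K := K) (V := vanishingOn K _), finrank_vanishingOn,
    Nat.cast_pow, Finset.prod_pow_eq_pow_sum]
  rw [Finset.sum_tsub_distrib _ fun i _ => Finset.card_le_univ _]
  simp [sq]

/-! ### The main estimate and the choice of parameters -/

/-- The main estimate, with the last `t` columns exposed after the first `m`. -/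
theorem abs_zeroPatternCount_sub_le (K : Type*) [Field K] [Fintype K] {m t g k : ℕ}
    (S : Fin (m + t) → Finset (Fin (m + t))) (hgt : g ≤ t) (hS : ∀ i, (S i).card ≤ g)
    (hmem : ∀ i, ∀ l ∈ S i, 2 * t ≤ Nat.card {j : Fin m // l ∉ S (Fin.castAdd t j)})
    (hk : k ≤ t) :
    |(zeroPatternCount K S (m + t - k) : ℝ) / (Nat.card K : ℝ) ^ ((m + t) ^ 2 - ∑ i, (S i).card) -
      corankLimit (Nat.card K) k| ≤ 9 * (2 ^ (m + t) / (Nat.card K : ℝ) ^ (t - g)) := by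
  classical
  set V₁ := fun i : Fin m => vanishingOn K (S (Fin.castAdd t i))
  set V₂ := fun i : Fin t => vanishingOn K (S (Fin.natAdd m i))
  set P := ∏ i, Nat.card (V₁ i) with hP
  have hq2 : 2 ≤ Nat.card K := Finite.one_lt_card
  have hq : 0 < Nat.card K := Nat.card_pos
  have hfin : ∀ s : Finset (Fin (m + t)),
      Module.finrank K (vanishingOn K s) = m + t - s.card := fun s => by
    rw [finrank_vanishingOn, Fintype.card_fin]
  have hbad₁ : Nat.card {a : ∀ i, V₁ i // ¬ LinearIndependent K fun i =>
      (a i : Fin (m + t) → K)} * Nat.card K ^ (t - g) ≤ P := by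
    have h := natCard_not_linearIndependent_le V₁ (w := m + (t - g)) fun i => by
      have := hS (Fin.castAdd t i)
      rw [hfin]
      omega
    rw [pow_add, mul_left_comm] at h
    exact Nat.le_of_mul_le_mul_left h (by positivity)
  have hbad₂ : ∀ i, Nat.card {a : ∀ i, V₁ i // Submodule.span K (Set.range fun i =>
      (a i : Fin (m + t) → K)) ⊔ V₂ i ≠ ⊤} * Nat.card K ^ (t - g) ≤ P := by
    intro i
    have h := natCard_not_sup_eq_top_le V₁ (V₂ i) (w := 2 * t) fun φ hφ hle => by
      obtain ⟨l, hl⟩ := exists_mem_of_vanishingOn_le_ker hφ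
      exact (hmem _ l (hl _ hle)).trans (Nat.card_le_card_of_injective
        (Subtype.map id fun j hj hle' => hj (hl _ hle'))
        (Subtype.map_injective _ Function.injective_id))
    have hi := hS (Fin.natAdd m i)
    have hi' := Finset.card_le_univ (S (Fin.natAdd m i))
    rw [Fintype.card_fin] at hi'
    have e : Module.finrank K (V₂ i) + 2 * t =
        (m + t) + ((t - g) + (g - (S (Fin.natAdd m i)).card + t)) := by
      rw [hfin]
      omega
    rw [Module.finrank_fin_fun, e, pow_add, mul_left_comm] at h
    refine le_trans (Nat.mul_le_mul_left _ ?_) (Nat.le_of_mul_le_mul_left h (by positivity))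
    exact Nat.pow_le_pow_right hq (by omega)
  have hbad : Nat.card {a : ∀ i, V₁ i // ¬ ((LinearIndependent K fun i =>
      (a i : Fin (m + t) → K)) ∧ ∀ i, Submodule.span K (Set.range fun i =>
        (a i : Fin (m + t) → K)) ⊔ V₂ i = ⊤)} * Nat.card K ^ (t - g) ≤ 2 ^ (m + t) * P := by
    have h : Nat.card {a : ∀ i, V₁ i // ¬ ((LinearIndependent K fun i =>
      (a i : Fin (m + t) → K)) ∧ ∀ i, Submodule.span K (Set.range fun i =>
        (a i : Fin (m + t) → K)) ⊔ V₂ i = ⊤)} ≤ _ :=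
      le_trans (Nat.card_le_card_of_injective (Subtype.map id fun a ha => ?_)
        (Subtype.map_injective _ Function.injective_id))
        -- `none` indexes dependence and `some i` failed transversality to `V₂ i`: `t + 1` events,
        -- at most `2 ^ (m + t)`.
        (natCard_subtype_exists_le fun (o : Option (Fin t)) (a : ∀ i, V₁ i) =>
          o.elim (¬ LinearIndependent K fun i => (a i : Fin (m + t) → K)) fun i =>
            Submodule.span K (Set.range fun i => (a i : Fin (m + t) → K)) ⊔ V₂ i ≠ ⊤)
    swap
    · rw [not_and_or, not_forall] at ha
      rcases ha with ha | ⟨i, ha⟩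
      exacts [⟨none, ha⟩, ⟨some i, ha⟩]
    refine (Nat.mul_le_mul_right _ h).trans ?_
    rw [Finset.sum_mul]
    refine (Finset.sum_le_card_nsmul _ _ P fun o _ => ?_).trans ?_
    · cases o with
      | none => exact hbad₁
      | some i => exact hbad₂ i
    · rw [Finset.card_univ, Fintype.card_option, Fintype.card_fin, smul_eq_mul]
      have : m + t < 2 ^ (m + t) := Nat.lt_two_pow_self
      exact Nat.mul_le_mul_right _ (by omega)
  have hQ : (0 : ℝ) < (Nat.card K : ℝ) ^ (t - g) := by positivity
  have hmain := abs_natCard_finrank_span_sub_le (K := K) (W := Fin (m + t) → K) (m := m) (t := t)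
    (by simp) V₁ V₂ (β := 2 ^ (m + t) / (Nat.card K : ℝ) ^ (t - g)) (by
      rw [div_mul_eq_mul_div, le_div_iff₀ hQ, ← Nat.cast_prod]
      exact_mod_cast hbad) (t - k)
  rw [prod_natCard_vanishingOn K S, ← zeroPatternCount_eq, ← Nat.add_sub_assoc hk] at hmain
  set T : ℝ := (Nat.card K : ℝ) ^ ((m + t) ^ 2 - ∑ i, (S i).card)
  have hT : 0 < T := by positivity
  have hlim := abs_rankLaw_sub_corankLimit_le hq2 (t - k) k
  rw [Nat.sub_add_cancel hk] at hlim
  have h1 : |(zeroPatternCount K S (m + t - k) : ℝ) / T - rankLaw (1 / Nat.card K) t t (t - k)| ≤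
      2 ^ (m + t) / (Nat.card K : ℝ) ^ (t - g) := by
    rw [← mul_le_mul_iff_left₀ hT, ← abs_of_pos hT, ← abs_mul, abs_of_pos hT, sub_mul,
      div_mul_cancel₀ _ hT.ne', mul_comm (rankLaw _ _ _ _)]
    exact hmain
  -- The limit error `8 q^{-t}` is absorbed here, whence `9 = 1 + 8`.
  have h2 : (1 / Nat.card K : ℝ) ^ t ≤ 2 ^ (m + t) / (Nat.card K : ℝ) ^ (t - g) := by
    rw [one_div_pow]
    have hq1 : (1 : ℝ) ≤ Nat.card K := by exact_mod_cast hq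
    exact div_le_div₀ (by positivity) (one_le_pow₀ (by norm_num)) hQ
      (pow_le_pow_right₀ hq1 (Nat.sub_le _ _))
  have h3 := abs_sub_le ((zeroPatternCount K S (m + t - k) : ℝ) / T)
    (rankLaw (1 / Nat.card K) t t (t - k)) (corankLimit (Nat.card K) k)
  linarith

theorem mainTheorem9 :
    ∃ α₀ : ℝ, 0 < α₀ ∧ ∀ α : ℝ, 0 < α → α ≤ α₀ →
      ∃ C' c A : ℝ, 0 < C' ∧ 0 < c ∧ 0 < A ∧
        ∀ (K : Type*) [Field K] [Fintype K] (n : ℕ) (S : Fin n → Finset (Fin n)),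
          SparsePattern α S →
          ∀ r : ℕ, (1 - α) * (n : ℝ) ≤ (r : ℝ) → r ≤ n →
            ∃ E : ℝ,
              |E| ≤ A * (C' / (Fintype.card K : ℝ)) ^ (c * (n : ℝ)) ∧
              (zeroPatternCount K S r : ℝ) =
                (Fintype.card K : ℝ) ^ (n ^ 2 - ∑ i, (S i).card) *
                  (corankLimit (Fintype.card K) (n - r) + E) := by
  -- With `C' = 2 ^ (1 / α)` and `c = α`, the error term is `2 ^ n / q ^ (α n)`; it suffices that `t
  -- - g ≥ α n`.
  refine ⟨1 / 12, by norm_num, fun α hα hα' => ⟨2 ^ (1 / α), α, 9, by positivity, hα, by norm_num,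
    fun K _ _ n S hS r hr hrn => ?_⟩⟩
  simp only [← Nat.card_eq_fintype_card (α := K)]
  have hq : 0 < Nat.card K := Nat.card_pos
  have hq1 : (1 : ℝ) ≤ Nat.card K := by exact_mod_cast hq
  refine ⟨(zeroPatternCount K S r : ℝ) / (Nat.card K : ℝ) ^ (n ^ 2 - ∑ i, (S i).card) -
    corankLimit (Nat.card K) (n - r), ?_, by rw [add_sub_cancel]; field_simp⟩
  have hαn : 0 ≤ α * n := by positivity
  obtain ⟨t, ht⟩ : ∃ t, t = ⌈2 * (α * n)⌉₊ := ⟨_, rfl⟩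
  have ht1 : 2 * (α * n) ≤ t := ht ▸ Nat.le_ceil _
  have ht2 : (t : ℝ) < 2 * (α * n) + 1 := ht ▸ Nat.ceil_lt_add_one (by positivity)
  have htn : t ≤ n := ht ▸ Nat.ceil_le.2 (by nlinarith [Nat.cast_nonneg (α := ℝ) n])
  obtain ⟨g, hg⟩ : ∃ g, g = ⌊α * n⌋₊ := ⟨_, rfl⟩
  have hg1 : (g : ℝ) ≤ α * n := hg ▸ Nat.floor_le hαn
  have hgt : g ≤ t := by
    rw [← Nat.cast_le (α := ℝ)]
    linarith
  have hgS : ∀ i, (S i).card ≤ g := fun i => hg ▸ Nat.le_floor (hS.card_lt i).le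
  clear ht hg
  obtain ⟨m, rfl⟩ := Nat.exists_eq_add_of_le' htn
  obtain ⟨k, hk⟩ := Nat.exists_eq_add_of_le hrn
  have hkt : k ≤ t := by
    have : ((m + t : ℕ) : ℝ) = r + k := by exact_mod_cast hk
    rw [← Nat.cast_le (α := ℝ)]
    linarith
  obtain rfl : r = m + t - k := by omega
  rw [show m + t - (m + t - k) = k by omega]
  refine (abs_zeroPatternCount_sub_le K S hgt hgS (fun i l hl => ?_) hkt).trans ?_
  -- A nonempty `S i` forces `α n > 1`, which absorbs the rounding in `t`: the count is at least `12
  -- α n - t`, and `3 t < 6 α n + 3 ≤ 12 α n`.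
  · have h1 : (1 : ℝ) ≤ α * (m + t : ℕ) := by
      have : 1 ≤ (S i).card := Finset.card_pos.2 ⟨l, hl⟩
      have : (1 : ℝ) ≤ (S i).card := by exact_mod_cast this
      linarith [hS.card_lt i]
    have h2 : m ≤ Nat.card {j : Fin m // l ∉ S (Fin.castAdd t j)} +
        (Finset.univ.filter fun i => l ∈ S i).card := by
      have h3 := Finset.card_filter_add_card_filter_not (s := Finset.univ)
        fun j : Fin m => l ∈ S (Fin.castAdd t j)
      rw [Finset.card_univ, Fintype.card_fin] at h3
      have h4 : (Finset.univ.filter fun j : Fin m => l ∈ S (Fin.castAdd t j)).card ≤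
          (Finset.univ.filter fun i => l ∈ S i).card :=
        Finset.card_le_card_of_injOn (Fin.castAdd t) (fun j hj => by simpa using hj)
          (Fin.castAdd_injective m t).injOn
      rw [Nat.card_eq_fintype_card, Fintype.card_subtype]
      omega
    have h3 := hS.mem_le l
    rw [← Nat.cast_le (α := ℝ)] at h2 ⊢
    push_cast at h1 h2 h3 ht1 ht2 ⊢
    linarith
  · have h2 : ((2 : ℝ) ^ (1 / α) / Nat.card K) ^ (α * ((m + t : ℕ) : ℝ)) =
        2 ^ (m + t) / (Nat.card K : ℝ) ^ (α * ((m + t : ℕ) : ℝ)) := by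
      rw [Real.div_rpow (by positivity) (by positivity), ← Real.rpow_mul (by norm_num),
        ← mul_assoc, one_div_mul_cancel hα.ne', one_mul, Real.rpow_natCast]
    rw [h2, ← Real.rpow_natCast _ (t - g)]
    have h3 : α * ((m + t : ℕ) : ℝ) ≤ ((t - g : ℕ) : ℝ) := by
      rw [Nat.cast_sub hgt]
      linarith
    have := Real.rpow_le_rpow_of_exponent_le hq1 h3
    gcongr
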